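/- Let $\Lambda$ be an associative ring with identity; modules are left $\Lambda$-modules. Suppose that $\Lambda$ is left hereditary (every left ideal of $\Lambda$ is a projective module) and that the injective envelope of ${}_\Lambda\Lambda$ is projective. Let $\Lambda\text{-}\underline{\mathrm{Mod}}$ be the stable category of $\Lambda$: its objects are the $\Lambda$-modules, and its morphisms $A\to B$ are the classes of homomorphisms $A\to B$ of $\Lambda$-modules, two homomorphisms being identified if their difference factors through a projective module. Then $\Lambda\text{-}\underline{\mathrm{Mod}}$ is conormal: every epimorphism in $\Lambda\text{-}\underline{\mathrm{Mod}}$ is normal, i.e. is a cokernel of some morphism of $\Lambda\text{-}\underline{\mathrm{Mod}}$. -/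

import Mathlib

open CategoryTheory

universe u

/-- A (unital, associative, possibly noncommutative) ring is left hereditary if every left ideal
is projective as a left module. (For a noncommutative ring, `Ideal Λ` is the type of left
ideals.) -/
def IsLeftHereditary (Λ : Type u) [Ring Λ] : Prop :=
  ∀ I : Ideal Λ, Module.Projective Λ I

/-- `i : M → E` is an injective envelope: `E` is an injective module, `i` is a monomorphism, and
`E` is an essential extension of the image of `i`. -/
structure IsInjectiveEnvelope {Λ : Type u} [Ring Λ] {M E : Type u} [AddCommGroup M] [Module Λ M]
    [AddCommGroup E] [Module Λ E] (i : M →ₗ[Λ] E) : Prop where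
  injective_module : Module.Injective Λ E
  injective_map : Function.Injective i
  essential : ∀ N : Submodule Λ E, N ⊓ LinearMap.range i = ⊥ → N = ⊥

namespace StableCat

variable (Λ : Type u) [Ring Λ]

variable {Λ} in
/-- A homomorphism of left `Λ`-modules factors through a projective module. -/
def FactorsThroughProjective {A B : ModuleCat.{u} Λ} (f : A ⟶ B) : Prop :=
  ∃ (P : ModuleCat.{u} Λ) (a : A ⟶ P) (b : P ⟶ B), Module.Projective Λ P ∧ a ≫ b = f

/-- Two homomorphisms are equivalent if their difference factors through a projective. -/
def projRel : HomRel (ModuleCat.{u} Λ) :=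
  fun _ _ f g => FactorsThroughProjective (f - g)

variable {Λ}

theorem FactorsThroughProjective.zero (A B : ModuleCat.{u} Λ) :
    FactorsThroughProjective (0 : A ⟶ B) :=
  ⟨ModuleCat.of Λ PUnit.{u + 1}, 0, 0, inferInstanceAs (Module.Projective Λ PUnit.{u + 1}), by simp⟩

theorem FactorsThroughProjective.neg {A B : ModuleCat.{u} Λ} {f : A ⟶ B}
    (hf : FactorsThroughProjective f) : FactorsThroughProjective (-f) := by
  obtain ⟨P, a, b, hP, rfl⟩ := hf
  exact ⟨P, a, -b, hP, by simp⟩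

theorem FactorsThroughProjective.add {A B : ModuleCat.{u} Λ} {f g : A ⟶ B}
    (hf : FactorsThroughProjective f) (hg : FactorsThroughProjective g) :
    FactorsThroughProjective (f + g) := by
  obtain ⟨P, a, b, hP, rfl⟩ := hf
  obtain ⟨Q, c, d, hQ, rfl⟩ := hg
  refine ⟨ModuleCat.of Λ (P × Q), ModuleCat.ofHom (a.hom.prod c.hom),
    ModuleCat.ofHom (b.hom.coprod d.hom), inferInstanceAs (Module.Projective Λ (P × Q)), ?_⟩
  ext x
  simp

theorem FactorsThroughProjective.comp_left {A B C : ModuleCat.{u} Λ} (f : A ⟶ B) {g : B ⟶ C}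
    (hg : FactorsThroughProjective g) : FactorsThroughProjective (f ≫ g) := by
  obtain ⟨P, a, b, hP, rfl⟩ := hg
  exact ⟨P, f ≫ a, b, hP, by simp⟩

theorem FactorsThroughProjective.comp_right {A B C : ModuleCat.{u} Λ} {f : A ⟶ B}
    (hf : FactorsThroughProjective f) (g : B ⟶ C) : FactorsThroughProjective (f ≫ g) := by
  obtain ⟨P, a, b, hP, rfl⟩ := hf
  exact ⟨P, a, b ≫ g, hP, by simp⟩

instance projRel_congruence : Congruence (projRel Λ) where
  equivalence :=
    { refl := fun f => by
        simpa [projRel] using FactorsThroughProjective.zero _ _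
      symm := fun h => by
        simpa [projRel] using FactorsThroughProjective.neg h
      trans := fun h h' => by
        simpa [projRel] using FactorsThroughProjective.add h h' }
  comp_left f _ _ h := by
    simpa [projRel, Preadditive.comp_sub] using FactorsThroughProjective.comp_left f h
  comp_right g h := by
    simpa [projRel, Preadditive.sub_comp] using FactorsThroughProjective.comp_right h g

theorem projRel_add ⦃A B : ModuleCat.{u} Λ⦄ (f₁ f₂ g₁ g₂ : A ⟶ B) (hf : projRel Λ f₁ f₂)
    (hg : projRel Λ g₁ g₂) : projRel Λ (f₁ + g₁) (f₂ + g₂) := by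
  have h := FactorsThroughProjective.add hf hg
  rwa [sub_add_sub_comm] at h

end StableCat

/-- The (projectively) stable category of left `Λ`-modules: its objects are the left `Λ`-modules,
its morphisms are the homomorphisms modulo those that factor through a projective module. -/
abbrev StableCat (Λ : Type u) [Ring Λ] : Type (u + 1) :=
  Quotient (StableCat.projRel Λ)

/-- The additive structure on the stable category, induced by addition of homomorphisms. -/
noncomputable instance StableCat.preadditive (Λ : Type u) [Ring Λ] : Preadditive (StableCat Λ) :=
  Quotient.preadditive (StableCat.projRel Λ) StableCat.projRel_add

/-!
# The stable category of a left hereditary ring with projective injective envelope is conormal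

Up to a free summand of the source, a morphism `f : A → B` of modules is surjective. Suppose that
it is surjective and a stable epimorphism. Then it is a stable cokernel of its kernel `K → A`: if
the restriction of `h : A → C` to `K` factors as `K → P → C` with `P` projective, it is enough to
extend `K → P` to a map `A → P`, because `h` minus the composite `A → P → C` then factors through
`B`. The extension exists as soon as `P` embeds in a module `Q` that is both injective and
projective: the obstruction is a map `B → Q ⧸ P` whose composite with `f` factors through `Q`, so it
is stably zero because `f` is a stable epimorphism (`StableCat.exists_extend_ker`,
`StableCat.nonempty_normalEpi`).

The ring enters only through these embeddings. A projective `P` embeds in a free module, hence in a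
direct sum of copies of the injective envelope `E` of `Λ`, which is projective; this sum is
injective when `Λ` is left noetherian. To see that it is, note that submodules of projective modules
are projective over `Λ`, so a map to a projective module that vanishes on an essential submodule is
zero. Therefore a projective module with a finitely generated essential submodule is finitely
generated, and in particular `E` is. A submodule of `E` that is not finitely generated then contains
an infinite direct sum (`IsLeftHereditary.isNoetherian`), and this is impossible: the subsums of
such a sum have injective hulls in `E`, and the union of these hulls over the subsets outside a
nonprincipal ultrafilter is not projective (`IsLeftHereditary.not_iSupIndep`). Hence `E` is
noetherian, and so is `Λ`.
-/

/-! ### Hereditary rings: quotients of injectives and submodules of projectives -/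

variable {Λ : Type u} [Ring Λ]

theorem LinearMap.exists_desc_of_surjective {M N L : Type u} [AddCommGroup M] [Module Λ M]
    [AddCommGroup N] [Module Λ N] [AddCommGroup L] [Module Λ L] {f : M →ₗ[Λ] N}
    (hf : Function.Surjective f) {g : M →ₗ[Λ] L} (h : LinearMap.ker f ≤ LinearMap.ker g) :
    ∃ k : N →ₗ[Λ] L, ∀ x, k (f x) = g x := by
  refine ⟨(LinearMap.ker f).liftQ g h ∘ₗ (f.quotKerEquivOfSurjective hf).symm.toLinearMap,
    fun x => ?_⟩
  have : (f.quotKerEquivOfSurjective hf).symm (f x) = (LinearMap.ker f).mkQ x := by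
    rw [LinearEquiv.symm_apply_eq]; rfl
  simp only [LinearMap.comp_apply, LinearEquiv.coe_coe, this]
  rfl

theorem LinearMap.exists_lift_of_injective {M N L : Type u} [AddCommGroup M] [Module Λ M]
    [AddCommGroup N] [Module Λ N] [AddCommGroup L] [Module Λ L] {j : N →ₗ[Λ] L}
    (hj : Function.Injective j) {g : M →ₗ[Λ] L} (h : ∀ x, g x ∈ LinearMap.range j) :
    ∃ k : M →ₗ[Λ] N, ∀ x, j (k x) = g x := by
  refine ⟨(LinearEquiv.ofInjective j hj).symm.toLinearMap ∘ₗ g.codRestrict _ h, fun x => ?_⟩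
  exact congrArg Subtype.val ((LinearEquiv.ofInjective j hj).apply_symm_apply ⟨g x, h x⟩)

theorem Module.exists_injective_embedding (M : Type u) [AddCommGroup M] [Module Λ M] :
    ∃ (Q : Type u) (_ : AddCommGroup Q) (_ : Module Λ Q) (j : M →ₗ[Λ] Q),
      Module.Injective Λ Q ∧ Function.Injective j := by
  obtain ⟨⟨J, _, f, _⟩⟩ := EnoughInjectives.presentation (ModuleCat.of Λ M)
  exact ⟨J, inferInstance, inferInstance, f.hom,
    Module.injective_module_of_injective_object (R := Λ) (M := J),
    (ModuleCat.mono_iff_injective f).mp inferInstance⟩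

namespace IsLeftHereditary

theorem injective_quotient (hΛ : IsLeftHereditary Λ) {Q : Type u} [AddCommGroup Q] [Module Λ Q]
    [hQ : Module.Injective Λ Q] (K : Submodule Λ Q) : Module.Injective Λ (Q ⧸ K) := by
  refine Module.Baer.injective fun I g => ?_
  have := hΛ I
  obtain ⟨g₁, hg₁⟩ := Module.projective_lifting_property K.mkQ g K.mkQ_surjective
  obtain ⟨g₂, hg₂⟩ := Module.Baer.of_injective hQ I g₁
  refine ⟨K.mkQ ∘ₗ g₂, fun x hx => ?_⟩
  rw [← hg₁, LinearMap.comp_apply, hg₂ x hx, LinearMap.comp_apply]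

/-- Given a surjection `f : A → B`, embed `A` in an injective module `Q`. A map `N → B` then
extends to a map `P → Q ⧸ ker f`, because that quotient is injective, and lifts to `P → Q`,
because `P` is projective; on `N` the lift takes its values in `A`. -/
theorem projective_submodule (hΛ : IsLeftHereditary Λ) {P : Type u} [AddCommGroup P] [Module Λ P]
    [Module.Projective Λ P] (N : Submodule Λ P) : Module.Projective Λ N := by
  refine Module.Projective.of_lifting_property fun {A B} _ _ _ _ f g hf => ?_
  obtain ⟨Q, _, _, j, hQ, hj⟩ := Module.exists_injective_embedding (Λ := Λ) A
  set K := (LinearMap.ker f).map j with hK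
  have := hΛ.injective_quotient K
  have hjf : ∀ a, K.mkQ (j a) = 0 ↔ f a = 0 := fun a => by
    rw [Submodule.mkQ_apply, Submodule.Quotient.mk_eq_zero, hK,
      Submodule.mem_map]
    refine ⟨fun ⟨b, hb, hab⟩ => ?_, fun h => ⟨a, h, rfl⟩⟩
    rw [← hj hab]
    exact hb
  obtain ⟨jB, hjB⟩ := LinearMap.exists_desc_of_surjective hf (g := K.mkQ ∘ₗ j)
    fun a ha => (hjf a).2 ha
  obtain ⟨G, hG⟩ := Module.Injective.out N.subtype N.injective_subtype (jB ∘ₗ g)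
  obtain ⟨H, hH⟩ := Module.projective_lifting_property K.mkQ G K.mkQ_surjective
  have hmem : ∀ n : N, H n ∈ LinearMap.range j := fun n => by
    obtain ⟨a, ha⟩ := hf (g n)
    have h : K.mkQ (H n - j a) = 0 := by
      rw [map_sub, ← LinearMap.comp_apply K.mkQ j, ← hjB, ha,
        ← LinearMap.comp_apply K.mkQ H, hH, sub_eq_zero]
      exact hG n
    rw [Submodule.mkQ_apply, Submodule.Quotient.mk_eq_zero] at h
    obtain ⟨b, -, hb⟩ := h
    exact ⟨b + a, by rw [map_add, hb, sub_add_cancel]⟩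
  obtain ⟨k, hk⟩ := LinearMap.exists_lift_of_injective hj (g := H ∘ₗ N.subtype) hmem
  refine ⟨k, LinearMap.ext fun n => ?_⟩
  obtain ⟨a, ha⟩ := hf (g n)
  have hkn : j (k n) = H n := hk n
  rw [LinearMap.comp_apply, ← ha, ← sub_eq_zero, ← map_sub, ← hjf, map_sub, map_sub, hkn,
    ← LinearMap.comp_apply K.mkQ j, ← hjB, ha, ← LinearMap.comp_apply K.mkQ H, hH, sub_eq_zero]
  exact hG n

/-- The range of `f` is projective, so `ker f` is a direct summand; its complement is disjoint from
the essential submodule `T`, hence zero. -/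
theorem eq_zero_of_essential_le_ker (hΛ : IsLeftHereditary Λ) {M P : Type u} [AddCommGroup M]
    [Module Λ M] [AddCommGroup P] [Module Λ P] [Module.Projective Λ P] {T : Submodule Λ M}
    (hT : ∀ N : Submodule Λ M, Disjoint N T → N = ⊥) (f : M →ₗ[Λ] P)
    (hf : T ≤ LinearMap.ker f) : f = 0 := by
  have := hΛ.projective_submodule (LinearMap.range f)
  obtain ⟨s, hs⟩ := f.rangeRestrict.exists_rightInverse_of_surjective f.range_rangeRestrict
  have hs' : ∀ y, f.rangeRestrict (s y) = y := fun y => LinearMap.congr_fun hs y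
  have h0 : LinearMap.range s = ⊥ := by
    refine hT _ (Disjoint.mono_right hf ?_)
    rw [Submodule.disjoint_def]
    rintro _ ⟨y, rfl⟩ hy
    have : f.rangeRestrict (s y) = 0 := Subtype.ext hy
    rw [← hs' y, this, map_zero]
  ext m
  have h1 : s (f.rangeRestrict m) = 0 := by
    rw [← Submodule.mem_bot Λ, ← h0]; exact ⟨_, rfl⟩
  have h2 := hs' (f.rangeRestrict m)
  rw [h1, map_zero] at h2
  exact (congrArg Subtype.val h2).symm

end IsLeftHereditary

/-! ### Finite generation of projective modules -/

theorem LinearMap.exists_finset_support_subset {M N X : Type u} [AddCommGroup M] [Module Λ M]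
    [AddCommGroup N] [Module Λ N] [Module.Finite Λ M] (f : M →ₗ[Λ] X →₀ N) :
    ∃ F : Finset X, ∀ m, (f m).support ⊆ F := by
  classical
  obtain ⟨S, hS⟩ := Module.Finite.fg_top (R := Λ) (M := M)
  refine ⟨S.biUnion fun m => (f m).support, fun m => ?_⟩
  have h : (⊤ : Submodule Λ M) ≤ (Finsupp.supported N Λ
      (↑(S.biUnion fun m => (f m).support) : Set X)).comap f := by
    rw [← hS, Submodule.span_le]
    intro x hx
    simp only [SetLike.mem_coe, Submodule.mem_comap, Finsupp.mem_supported]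
    exact Finset.coe_subset.2 (Finset.subset_biUnion_of_mem (fun m => (f m).support) hx)
  exact Finset.coe_subset.1 ((Finsupp.mem_supported Λ _).1 (h (Submodule.mem_top (x := m))))

theorem Module.finite_of_finite_coordinates {P : Type u} [AddCommGroup P] [Module Λ P]
    {s : P →ₗ[Λ] P →₀ Λ} (hs : (Finsupp.linearCombination Λ id).comp s = LinearMap.id)
    (h : {x | ∃ p, s p x ≠ 0}.Finite) : Module.Finite Λ P := by
  refine ⟨⟨h.toFinset, eq_top_iff.2 fun p _ => ?_⟩⟩
  have hp : Finsupp.linearCombination Λ id (s p) = p := LinearMap.congr_fun hs p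
  rw [← hp, Finsupp.linearCombination_apply]
  refine Submodule.sum_mem _ fun x hx => Submodule.smul_mem _ _ (Submodule.subset_span ?_)
  simpa using ⟨p, Finsupp.mem_support_iff.1 hx⟩

theorem IsLeftHereditary.finite_of_essential_fg (hΛ : IsLeftHereditary Λ) {P : Type u}
    [AddCommGroup P] [Module Λ P] [Module.Projective Λ P] {N : Submodule Λ P} (hN : N.FG)
    (hess : ∀ L : Submodule Λ P, Disjoint L N → L = ⊥) : Module.Finite Λ P := by
  obtain ⟨s, hs⟩ := Module.projective_def'.1 ‹Module.Projective Λ P›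
  have : Module.Finite Λ N := Module.Finite.iff_fg.2 hN
  obtain ⟨F, hF⟩ := (s ∘ₗ N.subtype).exists_finset_support_subset
  refine Module.finite_of_finite_coordinates hs (F.finite_toSet.subset ?_)
  rintro x ⟨p, hp⟩
  by_contra hx
  -- The coordinate at `x` vanishes on the essential submodule `N`, hence everywhere.
  refine hp (LinearMap.congr_fun (hΛ.eq_zero_of_essential_le_ker hess
    (Finsupp.lapply x ∘ₗ s) fun n hn => ?_) p)
  by_contra h0
  exact hx (hF ⟨n, hn⟩ (Finsupp.mem_support_iff.2 h0))

/-- By Baer's criterion: a left ideal is finitely generated, so a map from it to `X →₀ E` takes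
its values in a finite subsum. -/
theorem Module.Injective.finsupp [IsNoetherianRing Λ] (X E : Type u) [AddCommGroup E] [Module Λ E]
    [hE : Module.Injective Λ E] : Module.Injective Λ (X →₀ E) := by
  refine Module.Baer.injective fun I g => ?_
  obtain ⟨F, hF⟩ := g.exists_finset_support_subset
  choose e he using fun x => Module.Baer.of_injective hE I (Finsupp.lapply x ∘ₗ g)
  refine ⟨∑ x ∈ F, Finsupp.lsingle x ∘ₗ e x, fun a ha => ?_⟩
  classical
  ext y
  simp only [LinearMap.sum_apply, LinearMap.comp_apply, he _ a ha, Finsupp.finsetSum_apply,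
    Finsupp.lsingle_apply, Finsupp.lapply_apply, Finsupp.single_apply, Finset.sum_ite_eq']
  split_ifs with hy
  · rfl
  · by_contra h
    exact hy (hF ⟨a, ha⟩ (Finsupp.mem_support_iff.2 (Ne.symm h)))

theorem Module.Projective.finsupp (X E : Type u) [AddCommGroup E] [Module Λ E]
    [Module.Projective Λ E] : Module.Projective Λ (X →₀ E) := by
  classical
  exact Module.Projective.of_equiv' (finsuppLequivDFinsupp Λ).symm

/-! ### Infinite direct sums in a finitely generated injective projective module -/

theorem Submodule.exists_disjoint_essential_sup {M : Type u} [AddCommGroup M] [Module Λ M]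
    (T : Submodule Λ M) :
    ∃ C : Submodule Λ M, Disjoint C T ∧ ∀ N : Submodule Λ M, Disjoint N (C ⊔ T) → N = ⊥ := by
  obtain ⟨C, hC, hmax⟩ := zorn_le₀ {C : Submodule Λ M | Disjoint C T} fun c hc hchain =>
    ⟨sSup c, hchain.directedOn.disjoint_sSup_left.2 fun b hb => hc hb, fun z hz => le_sSup hz⟩
  refine ⟨C, hC, fun N hN => ?_⟩
  have h := hmax (Disjoint.disjoint_sup_left_of_disjoint_sup_right hC hN) le_sup_right
  exact disjoint_self.1 (hN.mono_right ((le_sup_left.trans h).trans le_sup_left))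

theorem iSupIndep_of_disjoint_sup_range {M : Type u} [AddCommGroup M] [Module Λ M]
    {D : ℕ → Submodule Λ M} (h : ∀ n, Disjoint (D n) ((Finset.range n).sup D)) : iSupIndep D := by
  refine iSupIndep_iff_supIndep.2 fun s => ?_
  obtain ⟨n, hn⟩ := s.exists_nat_subset_range
  refine Finset.SupIndep.subset ?_ hn
  clear hn
  induction n with
  | zero => exact Finset.supIndep_empty D
  | succ n ih => rw [Finset.range_add_one]; exact ih.insert (h n)

/-- The sum of the `D n` is direct and embeds in `E ⧸ C`, so that the map extends to `E ⧸ C`. -/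
theorem Module.Injective.exists_extend_iSupIndep {E Q : Type u} [AddCommGroup E] [Module Λ E]
    [AddCommGroup Q] [Module Λ Q] [Module.Injective Λ Q] {D : ℕ → Submodule Λ E}
    (hD : iSupIndep D) {C : Submodule Λ E} (hC : Disjoint C (⨆ n, D n))
    (g : ∀ n, D n →ₗ[Λ] Q) :
    ∃ G : E →ₗ[Λ] Q, (∀ c ∈ C, G c = 0) ∧ ∀ n, ∀ x : D n, G x = g n x := by
  classical
  let φ : (Π₀ n, D n) →ₗ[Λ] E := DFinsupp.lsum ℕ fun n => (D n).subtype
  have hφ : Function.Injective φ := hD.dfinsupp_lsum_injective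
  have hφ' : Function.Injective (C.mkQ ∘ₗ φ) := by
    rw [← LinearMap.ker_eq_bot, LinearMap.ker_eq_bot']
    intro y hy
    refine hφ ?_
    rw [map_zero]
    refine Submodule.disjoint_def.1 hC _ ((Submodule.Quotient.mk_eq_zero C).1 hy) ?_
    rw [Submodule.iSup_eq_range_dfinsupp_lsum]
    exact ⟨y, rfl⟩
  obtain ⟨G, hG⟩ := Module.Injective.out (C.mkQ ∘ₗ φ) hφ' (DFinsupp.lsum ℕ g)
  refine ⟨G ∘ₗ C.mkQ, fun c hc => ?_, fun n x => ?_⟩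
  · rw [LinearMap.comp_apply, Submodule.mkQ_apply, (Submodule.Quotient.mk_eq_zero C).2 hc, map_zero]
  · have := hG (DFinsupp.single n x)
    rw [LinearMap.comp_apply] at this
    simpa [φ] using this

theorem Set.Infinite.exists_infinite_subset_compl_mem_ultrafilter {S : Set ℕ} (hS : S.Infinite)
    (U : Ultrafilter ℕ) : ∃ A ⊆ S, A.Infinite ∧ Aᶜ ∈ U := by
  obtain ⟨t, u, rfl, hd, hc⟩ := hS.exists_union_disjoint_cardinal_eq_of_infinite
  have htu : t.Finite ↔ u.Finite := by
    rw [← Cardinal.lt_aleph0_iff_set_finite, ← Cardinal.lt_aleph0_iff_set_finite, hc]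
  have ht : t.Infinite := fun h => hS (h.union (htu.1 h))
  have hu : u.Infinite := fun h => hS ((htu.2 h).union h)
  by_cases h : t ∈ U
  · exact ⟨u, Set.subset_union_right, hu, Filter.mem_of_superset h hd.subset_compl_right⟩
  · exact ⟨t, Set.subset_union_left, ht, Ultrafilter.compl_mem_iff_notMem.2 h⟩

/-- A finitely generated injective projective module over a left hereditary ring contains no
infinite direct sum. Enlarge `⨁ D n` by `C` to an essential submodule of `E`. Since a map from `E`
to a projective module is determined on an essential submodule, every set `A` of indices has a
unique idempotent `e A` of `E` that is the identity on `D n` for `n ∈ A` and zero on `C` and on the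
other `D n`. The ranges of the `e A`, for `A` outside a nonprincipal ultrafilter, form a directed
family whose union `J` is projective as a submodule of `E`. If only finitely many coordinates of
`J` in a dual basis are nonzero, then `J` is finitely generated, hence it is one of these ranges,
although it contains every `D n`. Otherwise, since a finitely generated module meets only finitely
many coordinates, infinitely many `D n` are met by some coordinate, and an infinite set of such
indices lies outside the ultrafilter: the range of its idempotent is finitely generated and meets
infinitely many coordinates. -/
theorem IsLeftHereditary.not_iSupIndep (hΛ : IsLeftHereditary Λ) {E : Type u} [AddCommGroup E]
    [Module Λ E] [Module.Injective Λ E] [Module.Projective Λ E] [Module.Finite Λ E]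
    {D : ℕ → Submodule Λ E} (hD : ∀ n, D n ≠ ⊥) : ¬ iSupIndep D := by
  intro hind
  classical
  obtain ⟨C, hC, hess⟩ := (⨆ n, D n).exists_disjoint_essential_sup
  -- A map from `E` to a projective module is determined by its values on `C` and the `D n`.
  have huniq : ∀ (P : Type u) [AddCommGroup P] [Module Λ P] [Module.Projective Λ P]
      (f g : E →ₗ[Λ] P), (∀ c ∈ C, f c = g c) → (∀ n, ∀ x ∈ D n, f x = g x) → f = g := by
    intro P _ _ _ f g hc hd
    refine sub_eq_zero.1 (hΛ.eq_zero_of_essential_le_ker hess (f - g)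
      (sup_le (fun c h => ?_) (iSup_le fun n x h => ?_)))
    · simp [hc c h]
    · simp [hd n x h]
  choose e heC heD using fun A : Set ℕ => Module.Injective.exists_extend_iSupIndep hind hC
    fun n => if n ∈ A then (D n).subtype else 0
  have he₁ : ∀ A, ∀ n ∈ A, ∀ x ∈ D n, e A x = x := fun A n hn x hx => by
    rw [heD A n ⟨x, hx⟩, if_pos hn]; rfl
  have he₀ : ∀ A, ∀ n ∉ A, ∀ x ∈ D n, e A x = 0 := fun A n hn x hx => by
    rw [heD A n ⟨x, hx⟩, if_neg hn]; rfl
  have hmul : ∀ A B, A ⊆ B → e B ∘ₗ e A = e A := fun A B hAB => by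
    refine huniq E _ _ (fun c hc => ?_) fun n x hx => ?_
    · simp [heC A c hc]
    · by_cases hn : n ∈ A
      · simp [he₁ A n hn x hx, he₁ B n (hAB hn) x hx]
      · simp [he₀ A n hn x hx]
  have hmono : ∀ A B, A ⊆ B → LinearMap.range (e A) ≤ LinearMap.range (e B) := by
    rintro A B hAB _ ⟨y, rfl⟩
    exact ⟨e A y, LinearMap.congr_fun (hmul A B hAB) y⟩
  let U := Filter.hyperfilter ℕ
  let ι := {A : Set ℕ // Aᶜ ∈ U}
  have : Nonempty ι := ⟨⟨∅, by rw [Set.compl_empty]; exact Filter.univ_mem⟩⟩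
  let R : ι → Submodule Λ E := fun A => LinearMap.range (e A)
  have hdir : Directed (· ≤ ·) R := fun A B =>
    ⟨⟨A ∪ B, by rw [Set.compl_union]; exact Filter.inter_mem A.2 B.2⟩,
      hmono _ _ Set.subset_union_left, hmono _ _ Set.subset_union_right⟩
  let J : Submodule Λ E := ⨆ A, R A
  have hRJ : ∀ A, R A ≤ J := le_iSup R
  have hmemJ : ∀ x, x ∈ J ↔ ∃ A, x ∈ R A := fun x => Submodule.mem_iSup_of_directed R hdir
  let pt : ℕ → ι := fun n => ⟨{n}, Filter.compl_mem_hyperfilter_of_finite (Set.finite_singleton n)⟩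
  have hDR : ∀ A : Set ℕ, ∀ n ∈ A, D n ≤ LinearMap.range (e A) := fun A n hn x hx =>
    ⟨x, he₁ A n hn x hx⟩
  have hDJ : ∀ n, D n ≤ J := fun n => (hDR {n} n rfl).trans (hRJ (pt n))
  have := hΛ.projective_submodule J
  obtain ⟨s, hs⟩ := Module.projective_def'.1 this
  -- Each `R A` is finitely generated, so that it meets only finitely many coordinates.
  have hfin : ∀ A, {y | ∃ x : J, (x : E) ∈ R A ∧ s x y ≠ 0}.Finite := fun A => by
    have : Module.Finite Λ (R A) := Module.Finite.range _
    obtain ⟨F, hF⟩ := (s ∘ₗ Submodule.inclusion (hRJ A)).exists_finset_support_subset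
    refine F.finite_toSet.subset ?_
    rintro y ⟨x, hx, hy⟩
    exact hF ⟨x, hx⟩ (Finsupp.mem_support_iff.2 hy)
  -- A nonzero coordinate is nonzero on some `D n`.
  have hne : ∀ y, (∃ x, s x y ≠ 0) → ∃ n, ∃ x : J, (x : E) ∈ D n ∧ s x y ≠ 0 := by
    rintro y ⟨x, hx⟩
    by_contra! h0
    obtain ⟨A, z, hz⟩ := (hmemJ x).1 x.2
    let f : E →ₗ[Λ] Λ :=
      Finsupp.lapply y ∘ₗ s ∘ₗ (e A).codRestrict J fun w => hRJ A ⟨w, rfl⟩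
    have hf : f = 0 := by
      refine huniq Λ _ _ (fun c hc => ?_) fun n w hw => ?_
      · have : (e A).codRestrict J (fun w => hRJ A ⟨w, rfl⟩) c = 0 := Subtype.ext (heC A c hc)
        simp [f, this]
      · refine h0 n _ ?_
        by_cases hn : n ∈ (A : Set ℕ)
        · simpa [he₁ A n hn w hw] using hw
        · simp [he₀ A n hn w hw]
    refine hx ?_
    have hx' : (e A).codRestrict J (fun w => hRJ A ⟨w, rfl⟩) z = x := Subtype.ext hz
    rw [← hx']
    exact LinearMap.congr_fun hf z
  by_cases hX : {y | ∃ x, s x y ≠ 0}.Finite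
  · have hJ : Module.Finite Λ J := Module.finite_of_finite_coordinates hs hX
    obtain ⟨A, hA⟩ : ∃ A, J ≤ R A := by
      obtain ⟨S, hS⟩ := Module.Finite.iff_fg.1 hJ
      choose a ha using fun x : S => (hmemJ x).1 (hS ▸ Submodule.subset_span x.2)
      obtain ⟨A, hA⟩ := hdir.finset_le (Finset.univ.image a)
      refine ⟨A, hS ▸ Submodule.span_le.2 fun x hx => ?_⟩
      exact hA _ (Finset.mem_image_of_mem a (Finset.mem_univ ⟨x, hx⟩)) (ha ⟨x, hx⟩)
    obtain ⟨n, hn⟩ : ∃ n, n ∉ (A : Set ℕ) := by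
      by_contra! h
      exact Filter.empty_notMem (U : Filter ℕ) (by
        have := A.2
        rwa [Set.eq_univ_of_forall h, Set.compl_univ] at this)
    refine hD n ((Submodule.eq_bot_iff _).2 fun x hx => ?_)
    obtain ⟨z, hz⟩ := hA (hDJ n hx)
    rw [← he₀ A n hn x hx, ← hz]
    exact (LinearMap.congr_fun (hmul A A subset_rfl) z).symm
  · choose! ν hν using hne
    -- The fibres of `ν` are finite, so that its image is infinite.
    have hS : (ν '' {y | ∃ x, s x y ≠ 0}).Infinite := fun h => by
      refine hX (Set.Finite.of_finite_fibers ν h ?_)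
      rintro n -
      refine (hfin (pt n)).subset ?_
      rintro y ⟨hy, rfl⟩
      obtain ⟨x, hx, hxy⟩ := hν y hy
      exact ⟨x, hDR {ν y} _ rfl hx, hxy⟩
    obtain ⟨A, hAS, hA, hAU⟩ := hS.exists_infinite_subset_compl_mem_ultrafilter U
    refine hA (((hfin ⟨A, hAU⟩).image ν).subset fun n hn => ?_)
    obtain ⟨y, hy, rfl⟩ := hAS hn
    obtain ⟨x, hx, hxy⟩ := hν y hy
    exact ⟨y, ⟨x, hDR A _ hn hx, hxy⟩, rfl⟩

/-- In a submodule `J` of `E` that is not finitely generated, every finitely generated submodule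
misses some nonzero cyclic submodule, so that `J` contains an infinite direct sum. -/
theorem IsLeftHereditary.isNoetherian (hΛ : IsLeftHereditary Λ) (E : Type u) [AddCommGroup E]
    [Module Λ E] [Module.Injective Λ E] [Module.Projective Λ E] [Module.Finite Λ E] :
    IsNoetherian Λ E := by
  refine ⟨fun J => ?_⟩
  by_contra hJ
  have := hΛ.projective_submodule J
  -- No finitely generated submodule `N` of `J` is essential in `J`.
  have step : ∀ N : Submodule Λ E, N ≤ J → N.FG → ∃ a ∈ J, a ≠ 0 ∧ Disjoint (Λ ∙ a) N := by
    intro N hNJ hN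
    by_contra! h
    refine hJ (Module.Finite.iff_fg.1 (hΛ.finite_of_essential_fg (P := J)
      (N := N.comap J.subtype) ?_ fun L hL => ?_))
    · refine Submodule.fg_of_fg_map_injective J.subtype J.injective_subtype ?_
      rwa [Submodule.map_comap_subtype, inf_eq_right.2 hNJ]
    · refine (Submodule.eq_bot_iff _).2 fun x hx => ?_
      by_contra hx0
      refine h x x.2 (fun h => hx0 (Subtype.ext h)) ?_
      rw [Submodule.disjoint_def]
      intro y hy hyN
      obtain ⟨r, rfl⟩ := Submodule.mem_span_singleton.1 hy
      exact congrArg Subtype.val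
        (Submodule.disjoint_def.1 hL (r • x) (L.smul_mem r hx) hyN)
  choose! a haJ ha0 had using step
  let N : ℕ → Submodule Λ E := Nat.rec ⊥ fun _ N => N ⊔ Λ ∙ a N
  have hN : ∀ n, N n ≤ J ∧ (N n).FG := by
    intro n
    induction n with
    | zero => exact ⟨bot_le, Submodule.fg_bot⟩
    | succ n ih =>
      refine ⟨sup_le ih.1 ((Submodule.span_singleton_le_iff_mem _ _).2 (haJ _ ih.1 ih.2)),
        ih.2.sup (Submodule.fg_span_singleton _)⟩
  have hsup : ∀ n, (Finset.range n).sup (fun k => Λ ∙ a (N k)) = N n := by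
    intro n
    induction n with
    | zero => rfl
    | succ n ih => rw [Finset.range_add_one, Finset.sup_insert, ih, sup_comm]
  refine hΛ.not_iSupIndep (D := fun n => Λ ∙ a (N n)) (fun n h => ?_)
    (iSupIndep_of_disjoint_sup_range fun n => ?_)
  · exact ha0 _ (hN n).1 (hN n).2 (Submodule.span_singleton_eq_bot.1 h)
  · rw [hsup]
    exact had _ (hN n).1 (hN n).2

/-! ### Embedding projective modules in injective projective modules -/

/-- The essential submodule `Λ` makes `E` finitely generated, hence noetherian, so that `Λ` is left
noetherian. The module `P` embeds in a free module by a splitting of a free cover, and the free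
module in the corresponding direct sum of copies of `E`. -/
theorem IsLeftHereditary.exists_injective_projective_embedding (hΛ : IsLeftHereditary Λ)
    {E : Type u} [AddCommGroup E] [Module Λ E] {i : Λ →ₗ[Λ] E} (hi : IsInjectiveEnvelope i)
    [Module.Projective Λ E] (P : Type u) [AddCommGroup P] [Module Λ P]
    [Module.Projective Λ P] :
    ∃ (Q : Type u) (_ : AddCommGroup Q) (_ : Module Λ Q) (j : P →ₗ[Λ] Q),
      Module.Injective Λ Q ∧ Module.Projective Λ Q ∧ Function.Injective j := by
  have := hi.injective_module
  have : Module.Finite Λ E := by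
    refine hΛ.finite_of_essential_fg (N := LinearMap.range i) ?_ fun L hL =>
      hi.essential L hL.eq_bot
    exact Module.Finite.iff_fg.1 (Module.Finite.range i)
  have := hΛ.isNoetherian E
  have : IsNoetherianRing Λ := isNoetherian_of_injective i hi.injective_map
  obtain ⟨s, hs⟩ := Module.projective_def'.1 ‹Module.Projective Λ P›
  refine ⟨P →₀ E, inferInstance, inferInstance, Finsupp.mapRange.linearMap i ∘ₗ s,
    Module.Injective.finsupp P E, Module.Projective.finsupp P E, ?_⟩
  refine (Finsupp.mapRange_injective _ (map_zero i) hi.injective_map).comp ?_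
  exact Function.LeftInverse.injective (g := Finsupp.linearCombination Λ id)
    (LinearMap.congr_fun hs)

/-! ### Epimorphisms of the stable category -/

namespace StableCat

open Limits

theorem functor_map_eq_zero_iff {A B : ModuleCat.{u} Λ} (f : A ⟶ B) :
    (Quotient.functor (projRel Λ)).map f = 0 ↔ FactorsThroughProjective f := by
  have h0 : (Quotient.functor (projRel Λ)).map (0 : A ⟶ B) = 0 := rfl
  rw [← h0, Quotient.functor_map_eq_iff]
  simp [projRel]

theorem factorsThroughProjective_of_epi {A B : ModuleCat.{u} Λ} (f : A ⟶ B)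
    [Epi ((Quotient.functor (projRel Λ)).map f)] {C : ModuleCat.{u} Λ} (u : B ⟶ C)
    (h : FactorsThroughProjective (f ≫ u)) : FactorsThroughProjective u := by
  rw [← functor_map_eq_zero_iff] at h ⊢
  rw [Functor.map_comp] at h
  exact (cancel_epi _).1 (h.trans comp_zero.symm)

/-- Let `f` be surjective and a stable epimorphism, and let `j : P → Q` embed a projective module
in an injective projective one. Every `α : ker f → P` then extends to the source of `f`. Indeed
`j ∘ α` extends to `β : A → Q`, which induces `B → Q ⧸ P`; as the composite with `f` factors
through `Q`, this map factors through a projective module, so it lifts to `γ : B → Q`. The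
difference `β - γ ∘ f` takes its values in `P` and agrees with `α` on `ker f`. -/
theorem exists_extend_ker {A B P Q : Type u} [AddCommGroup A] [Module Λ A] [AddCommGroup B]
    [Module Λ B] [AddCommGroup P] [Module Λ P] [AddCommGroup Q] [Module Λ Q]
    [Module.Injective Λ Q] [Module.Projective Λ Q] {j : P →ₗ[Λ] Q} (hj : Function.Injective j)
    {f : A →ₗ[Λ] B} (hf : Function.Surjective f)
    (hepi : ∀ (C : ModuleCat.{u} Λ) (u : ModuleCat.of Λ B ⟶ C),
      FactorsThroughProjective (ModuleCat.ofHom f ≫ u) → FactorsThroughProjective u)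
    (α : LinearMap.ker f →ₗ[Λ] P) : ∃ r : A →ₗ[Λ] P, ∀ x : LinearMap.ker f, r x = α x := by
  obtain ⟨β, hβ⟩ := Module.Injective.out (LinearMap.ker f).subtype
    (LinearMap.ker f).injective_subtype (j ∘ₗ α)
  set π := (LinearMap.range j).mkQ with hπ
  have hπ0 : ∀ q, π q = 0 ↔ q ∈ LinearMap.range j := fun q => Submodule.Quotient.mk_eq_zero _
  obtain ⟨b, hb⟩ := LinearMap.exists_desc_of_surjective hf (g := π ∘ₗ β)
    fun a ha => (hπ0 _).2 ⟨α ⟨a, ha⟩, (hβ ⟨a, ha⟩).symm⟩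
  obtain ⟨P', u, v, hP', huv⟩ := hepi (ModuleCat.of Λ _) (ModuleCat.ofHom b)
    ⟨ModuleCat.of Λ Q, ModuleCat.ofHom β, ModuleCat.ofHom π, ‹_›, by
      ext a; exact (hb a).symm⟩
  obtain ⟨w, hw⟩ := Module.projective_lifting_property π v.hom (Submodule.mkQ_surjective _)
  have hγ : ∀ y, π (w (u.hom y)) = b y := fun y => by
    rw [← LinearMap.comp_apply π w, hw]
    exact LinearMap.congr_fun (congrArg ModuleCat.Hom.hom huv) y
  let δ : A →ₗ[Λ] Q := β - w ∘ₗ u.hom ∘ₗ f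
  have hδ : ∀ a, δ a ∈ LinearMap.range j := fun a => by
    rw [← hπ0]
    change π (β a - w (u.hom (f a))) = 0
    rw [map_sub, hγ, hb, LinearMap.comp_apply, sub_self]
  obtain ⟨r, hr⟩ := LinearMap.exists_lift_of_injective hj hδ
  refine ⟨r, fun x => hj ?_⟩
  rw [hr]
  change β x - w (u.hom (f x)) = j (α x)
  rw [LinearMap.mem_ker.1 x.2, map_zero, map_zero, sub_zero]
  exact hβ x

/-- The kernel of the surjection `A × F → B` given by `f` and a free cover `p : F → B`, with its
projection to `A`, has the cokernel `f` in the stable category if `f` is a stable epimorphism. If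
the restriction of `h : A → C` to it factors through a projective `P`, the map from the kernel to
`P` extends to `r : A × F → P`, and `h` minus the map through `r` factors through `B`. -/
theorem nonempty_normalEpi
    (hemb : ∀ (P : Type u) [AddCommGroup P] [Module Λ P] [Module.Projective Λ P],
      ∃ (Q : Type u) (_ : AddCommGroup Q) (_ : Module Λ Q) (j : P →ₗ[Λ] Q),
        Module.Injective Λ Q ∧ Module.Projective Λ Q ∧ Function.Injective j)
    {A B : ModuleCat.{u} Λ} (f : A ⟶ B) [Epi ((Quotient.functor (projRel Λ)).map f)] :
    Nonempty (NormalEpi ((Quotient.functor (projRel Λ)).map f)) := by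
  let F := B →₀ Λ
  let p : F →ₗ[Λ] B := Finsupp.linearCombination Λ id
  let f₁ : A × F →ₗ[Λ] B := f.hom.coprod p
  have hf₁ : Function.Surjective f₁ := fun y => ⟨(0, Finsupp.single y 1), by
    rw [LinearMap.coprod_apply, map_zero, zero_add, Finsupp.linearCombination_single, one_smul, id]⟩
  let g : ModuleCat.of Λ (LinearMap.ker f₁) ⟶ A :=
    ModuleCat.ofHom (LinearMap.fst Λ A F ∘ₗ (LinearMap.ker f₁).subtype)
  have hepi : ∀ (C : ModuleCat.{u} Λ) (u : ModuleCat.of Λ B ⟶ C),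
      FactorsThroughProjective (ModuleCat.ofHom f₁ ≫ u) → FactorsThroughProjective u := by
    intro C u hu
    refine factorsThroughProjective_of_epi f u ?_
    have : f ≫ u = ModuleCat.ofHom (LinearMap.inl Λ A F) ≫ ModuleCat.ofHom f₁ ≫ u := by
      ext a
      simp [f₁]
    rw [this]
    exact FactorsThroughProjective.comp_left _ hu
  have hw : FactorsThroughProjective (g ≫ f) := by
    refine ⟨ModuleCat.of Λ F, ModuleCat.ofHom (-LinearMap.snd Λ A F ∘ₗ (LinearMap.ker f₁).subtype),
      ModuleCat.ofHom p, inferInstanceAs (Module.Projective Λ (B →₀ Λ)), ?_⟩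
    ext x
    have hx : f.hom x.1.1 + p x.1.2 = 0 := x.2
    change p (-x.1.2) = f.hom x.1.1
    rw [map_neg, eq_comm, eq_neg_iff_add_eq_zero, hx]
  have hdesc : ∀ {C : ModuleCat.{u} Λ} (h : A ⟶ C), FactorsThroughProjective (g ≫ h) →
      ∃ k : B ⟶ C, FactorsThroughProjective (f ≫ k - h) := by
    rintro C h ⟨P, α, b, hP, hαb⟩
    obtain ⟨Q, _, _, j, _, _, hj⟩ := hemb P
    obtain ⟨r, hr⟩ := exists_extend_ker hj hf₁ hepi α.hom
    let d : A × F →ₗ[Λ] C := h.hom ∘ₗ LinearMap.fst Λ A F - b.hom ∘ₗ r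
    have hd : LinearMap.ker f₁ ≤ LinearMap.ker d := fun x hx => by
      have h1 : b.hom (α.hom ⟨x, hx⟩) = h.hom x.1 :=
        LinearMap.congr_fun (congrArg ModuleCat.Hom.hom hαb) ⟨x, hx⟩
      change h.hom x.1 - b.hom (r x) = 0
      rw [← h1, hr ⟨x, hx⟩, sub_self]
    obtain ⟨k, hk⟩ := LinearMap.exists_desc_of_surjective hf₁ hd
    refine ⟨ModuleCat.ofHom k, P, ModuleCat.ofHom (-r ∘ₗ LinearMap.inl Λ A F), b, hP, ?_⟩
    ext a
    have h2 := hk (a, 0)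
    have h3 : f₁ (a, 0) = f.hom a := by simp [f₁]
    rw [h3] at h2
    change b.hom (-r (a, 0)) = k (f.hom a) - h.hom a
    rw [h2]
    change _ = h.hom a - b.hom (r (a, 0)) - h.hom a
    rw [map_neg]
    abel
  have hw' : (Quotient.functor (projRel Λ)).map g ≫ (Quotient.functor (projRel Λ)).map f = 0 := by
    rw [← Functor.map_comp, functor_map_eq_zero_iff]
    exact hw
  have hd : ∀ {Z : StableCat Λ} (h : (Quotient.functor (projRel Λ)).obj A ⟶ Z),
      (Quotient.functor (projRel Λ)).map g ≫ h = 0 →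
        ∃ k : (Quotient.functor (projRel Λ)).obj B ⟶ Z,
          (Quotient.functor (projRel Λ)).map f ≫ k = h := by
    rintro ⟨C⟩ h hgh
    obtain ⟨h, rfl⟩ := (Quotient.functor (projRel Λ)).map_surjective (Y := C) h
    rw [← Functor.map_comp, functor_map_eq_zero_iff] at hgh
    obtain ⟨k, hk⟩ := hdesc h hgh
    refine ⟨(Quotient.functor (projRel Λ)).map k, ?_⟩
    rw [← Functor.map_comp, Quotient.functor_map_eq_iff]
    exact hk
  exact ⟨{  W := _
            g := (Quotient.functor (projRel Λ)).map g
            w := hw'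
            isColimit := CokernelCofork.IsColimit.ofπ _ _ (fun h hh => (hd h hh).choose)
              (fun h hh => (hd h hh).choose_spec)
              (fun h hh m hm => by
                rw [← cancel_epi ((Quotient.functor (projRel Λ)).map f), hm,
                  (hd h hh).choose_spec]) }⟩

end StableCat

theorem lemma8p8 (Λ : Type u) [Ring Λ] (hΛ : IsLeftHereditary Λ)
    (E : Type u) [AddCommGroup E] [Module Λ E] (i : Λ →ₗ[Λ] E) (hi : IsInjectiveEnvelope i)
    (hE : Module.Projective Λ E) :
    IsNormalEpiCategory (StableCat Λ) := by
  refine ⟨?_⟩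
  rintro ⟨A⟩ ⟨B⟩ f hf
  obtain ⟨f, rfl⟩ := (Quotient.functor (StableCat.projRel Λ)).map_surjective (X := A) (Y := B) f
  exact StableCat.nonempty_normalEpi
    (fun P _ _ _ => hΛ.exists_injective_projective_embedding hi P) f
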